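/- Let $F(X)$ be the free group with countably infinite basis $X=\{x_1,x_2,\dots\}$. For a word $w=w(x_1,\dots,x_n)\in F(X)$ and a group $G$ let $w[G]=\{w(g_1,\dots,g_n)\mid g_1,\dots,g_n\in G\}$ be the verbal set of $w$ in $G$. The word $w$ is called proper if there exist groups $G$ and $G'$ with $w[G]\neq\{1\}$ and $w[G']\neq G'$. The rational subsets of a group $H$ form the smallest family of subsets of $H$ that contains all finite subsets and is closed under the operations $(K,L)\mapsto K\cup L$, $(K,L)\mapsto KL=\{ab\mid a\in K,\ b\in L\}$, and $L\mapsto L^*$, where $L^*$ is the submonoid of $H$ generated by $L$. Let $H$ be one of the following groups: 1) a pure braid group $PB_n$ with $n\ge 3$, that is, the kernel of the homomorphism from the braid group $B_n$ on $n$ strands onto the symmetric group $S_n$ that sends each braid to the permutation of its strands; 2) a non-abelian right-angled Artin group, that is, the group generated by the vertices of a simple graph (finite or infinite) subject to the relations $uv=vu$ for all pairs of adjacent vertices $u,v$; 3) a finitely generated non-abelian residually free group, where $H$ is residually free if for every $g\in H$ with $g\neq 1$ there is a homomorphism $\varphi$ from $H$ to a free group with $\varphi(g)\neq 1$. Then for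 every proper word $w$ the set $w[H]$ is not a rational subset of $H$. Moreover, $H$ has the free group $F_2$ of rank $2$ as a quotient. -/

import Mathlib

open scoped Pointwise

universe u v p q

/-- The rational subsets of a monoid `M`: the smallest family of subsets that contains the finite
sets and is closed under union, (elementwise) product, and generation of a submonoid. -/
inductive IsRationalSet {M : Type*} [Monoid M] : Set M → Prop
  | finite (L : Set M) (hL : L.Finite) : IsRationalSet L
  | union (K L : Set M) (hK : IsRationalSet K) (hL : IsRationalSet L) : IsRationalSet (K ∪ L)
  | mul (K L : Set M) (hK : IsRationalSet K) (hL : IsRationalSet L) : IsRationalSet (K * L)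
  | star (L : Set M) (hL : IsRationalSet L) : IsRationalSet (Submonoid.closure L : Set M)

/-- The verbal set `w[G]` of a word `w` in the free group with basis `x₀, x₁, x₂, …`: all values
of `w` under substitutions of elements of `G` for the letters. -/
def verbalSet (w : FreeGroup ℕ) (G : Type*) [Group G] : Set G :=
  {g | ∃ a : ℕ → G, FreeGroup.lift a w = g}

/-- A word `w` is proper if there are groups `G` and `H` with `w[G] ≠ {1}` and `w[H] ≠ H`. -/
def IsProperWord (w : FreeGroup ℕ) : Prop :=
  (∃ (G : Type p) (_ : Group G), verbalSet w G ≠ {1}) ∧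
    ∃ (H : Type q) (_ : Group H), verbalSet w H ≠ Set.univ

/-- The relators of Artin's presentation of the braid group on `n` strands, with generators
`σ₀, …, σ_{n-2}`. -/
inductive BraidRel (n : ℕ) : FreeGroup (Fin (n - 1)) → Prop
  | comm (i j : Fin (n - 1)) (h : (i : ℕ) + 2 ≤ j) :
      BraidRel n (FreeGroup.of i * FreeGroup.of j * (FreeGroup.of j * FreeGroup.of i)⁻¹)
  | braid (i j : Fin (n - 1)) (h : (i : ℕ) + 1 = j) :
      BraidRel n (FreeGroup.of i * FreeGroup.of j * FreeGroup.of i *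
        (FreeGroup.of j * FreeGroup.of i * FreeGroup.of j)⁻¹)

/-- The braid group `B_n` on `n` strands. -/
abbrev BraidGroup (n : ℕ) : Type := PresentedGroup {r | BraidRel n r}

/-- The transposition of the neighbouring points `i` and `i + 1`. -/
def adjSwap (n : ℕ) (i : Fin (n - 1)) : Equiv.Perm (Fin n) :=
  Equiv.swap ⟨i, by omega⟩ ⟨i + 1, by omega⟩

theorem adjSwap_rel (n : ℕ) :
    ∀ r ∈ {r | BraidRel n r}, FreeGroup.lift (adjSwap n) r = 1 := by
  rintro r (⟨i, j, h⟩ | ⟨i, j, h⟩)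
  all_goals
    simp only [map_mul, map_inv, FreeGroup.lift_apply_of, mul_inv_eq_one]
    ext x
    simp only [adjSwap, Equiv.Perm.mul_apply, Equiv.swap_apply_def, Fin.ext_iff]
    grind

/-- The homomorphism from `B_n` onto the symmetric group that sends a braid to the permutation of
its strands. -/
def braidPerm (n : ℕ) : BraidGroup n →* Equiv.Perm (Fin n) :=
  PresentedGroup.toGroup (adjSwap_rel n)

/-- The pure braid group `PB_n`: the braids whose permutation is trivial. -/
abbrev PureBraidGroup (n : ℕ) : Subgroup (BraidGroup n) := (braidPerm n).ker

/-- The right-angled Artin group of a graph `Γ`: the generators are the vertices, and two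
generators commute when they are adjacent. -/
abbrev RightAngledArtinGroup {V : Type*} (Γ : SimpleGraph V) : Type _ :=
  PresentedGroup {r : FreeGroup V | ∃ u v : V, Γ.Adj u v ∧
    r = FreeGroup.of u * FreeGroup.of v * (FreeGroup.of v * FreeGroup.of u)⁻¹}

/-- A group `G` is residually free if for every `g ≠ 1` there is a homomorphism from `G` to a free
group that does not kill `g`. -/
def IsResiduallyFree (G : Type u) [Group G] : Prop :=
  ∀ g : G, g ≠ 1 → ∃ (ι : Type u) (φ : G →* FreeGroup ι), φ g ≠ 1

/-! Each of these groups maps onto $F_2$, and a surjection carries rational sets to rational sets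
and verbal sets onto verbal sets, so it suffices to treat $F_2$
(`IsProperWord.not_isRationalSet_verbalSet`). The tool is `IsRationalSet.pumping`: in the reduced
words of a rational set a block $a^m$ may grow to $a^{m+kt}$, with $m,k$ independent of the context.

If $w$ vanishes on $\mathbb Z$, take a nontrivial value of $w$, replace each basis element by its
$m$-th power and pump the first block: the exponent sum becomes nonzero, which no value of $w$
allows.

Otherwise $w[\mathbb Z]$ contains some $d>0$ but, $w$ being proper, not $1$. Then $w[F_2]$ contains
all powers $(x^my)^{ds}$, and pumping makes their $x$-runs pairwise distinct. The signed number of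
$x$-runs of exponent $\pm n$ is additive on a product for all but three $n$ (`exists_runCount_mul`),
hence sends a value of $w$ in $F_2$ to a value in $\mathbb Z$ for all but $3|w|$ of them. A long
pumped word has a run outside the exceptions; it occurs once, so $1\in w[\mathbb Z]$, a
contradiction.

The maps onto $F_2$ kill all but two non-adjacent vertices, or pass to a non-abelian free image, or
forget all but three strands and divide by the center of $PB_3$. -/

/-! ### Finite automata over a monoid -/

section Automata

variable {M Q : Type*} [Monoid M]

/-- `Reach E p g r`: some path from `p` to `r` in the labelled graph `E` spells `g`. -/
inductive Reach (E : Q → M → Q → Prop) : Q → M → Q → Prop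
  | refl (p : Q) : Reach E p 1 p
  | tail {p q r : Q} {g h : M} (hp : Reach E p g q) (e : E q h r) : Reach E p (g * h) r

theorem Reach.single {E : Q → M → Q → Prop} {p r : Q} {h : M} (e : E p h r) : Reach E p h r := by
  simpa using Reach.tail (Reach.refl p) e

theorem Reach.trans {E : Q → M → Q → Prop} {p q r : Q} {g h : M} (h₁ : Reach E p g q)
    (h₂ : Reach E q h r) : Reach E p (g * h) r := by
  induction h₂ with
  | refl => simpa using h₁
  | tail _ e ih => rw [← mul_assoc]; exact ih.tail e

theorem Reach.map {Q' : Type*} {E : Q → M → Q → Prop} {E' : Q' → M → Q' → Prop} (f : Q → Q')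
    (hf : ∀ p g q, E p g q → E' (f p) g (f q)) {p r : Q} {g : M} (h : Reach E p g r) :
    Reach E' (f p) g (f r) := by
  induction h with
  | refl => exact .refl _
  | tail _ e ih => exact ih.tail (hf _ _ _ e)

/-- `S` is accepted by a finite automaton all of whose edges carry labels from `A`. -/
def IsAccepted (A : Set M) (S : Set M) : Prop :=
  ∃ (Q : Type) (_ : Finite Q) (E : Q → M → Q → Prop) (I F : Set Q),
    (∀ p g q, E p g q → g ∈ A) ∧ S = {g | ∃ i ∈ I, ∃ f ∈ F, Reach E i g f}

theorem IsAccepted.empty (A : Set M) : IsAccepted A ∅ :=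
  ⟨Unit, inferInstance, fun _ _ _ => False, ∅, ∅, by simp, by simp⟩

theorem IsAccepted.singleton {A : Set M} {a : M} (ha : a ∈ A) : IsAccepted A {a} := by
  refine ⟨Bool, inferInstance, fun p g q => p = false ∧ q = true ∧ g = a, {false}, {true},
    fun p g q h => h.2.2 ▸ ha, ?_⟩
  ext g
  simp only [Set.mem_singleton_iff, Set.mem_ofPred_eq, exists_eq_left]
  constructor
  · rintro rfl
    exact .single ⟨rfl, rfl, rfl⟩
  · intro h
    cases h with
    | tail hp e =>
      obtain ⟨rfl, -, rfl⟩ := e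
      cases hp with
      | refl => simp
      | tail _ e => simp at e

theorem IsAccepted.union {A S T : Set M} (hS : IsAccepted A S) (hT : IsAccepted A T) :
    IsAccepted A (S ∪ T) := by
  obtain ⟨Q₁, _, E₁, I₁, F₁, h₁, rfl⟩ := hS
  obtain ⟨Q₂, _, E₂, I₂, F₂, h₂, rfl⟩ := hT
  let E : Q₁ ⊕ Q₂ → M → Q₁ ⊕ Q₂ → Prop := fun p g q =>
    (∃ p' q', p = .inl p' ∧ q = .inl q' ∧ E₁ p' g q') ∨
    (∃ p' q', p = .inr p' ∧ q = .inr q' ∧ E₂ p' g q')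
  have key : ∀ p g q, Reach E p g q → (∃ p' q', p = .inl p' ∧ q = .inl q' ∧ Reach E₁ p' g q') ∨
      (∃ p' q', p = .inr p' ∧ q = .inr q' ∧ Reach E₂ p' g q') := by
    intro p g q h
    induction h with
    | refl => rcases p with p | p <;> simp [Reach.refl]
    | tail _ e ih =>
      rcases ih with ⟨p', q', rfl, rfl, ih⟩ | ⟨p', q', rfl, rfl, ih⟩ <;>
      rcases e with ⟨p'', q'', hp, rfl, e⟩ | ⟨p'', q'', hp, rfl, e⟩ <;> cases hp
      · exact .inl ⟨_, _, rfl, rfl, ih.tail e⟩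
      · exact .inr ⟨_, _, rfl, rfl, ih.tail e⟩
  refine ⟨Q₁ ⊕ Q₂, inferInstance, E, .inl '' I₁ ∪ .inr '' I₂, .inl '' F₁ ∪ .inr '' F₂, ?_, ?_⟩
  · rintro p g q (⟨_, _, -, -, h⟩ | ⟨_, _, -, -, h⟩)
    exacts [h₁ _ _ _ h, h₂ _ _ _ h]
  · ext g
    constructor
    · rintro (⟨i, hi, f, hf, h⟩ | ⟨i, hi, f, hf, h⟩)
      · exact ⟨_, .inl ⟨i, hi, rfl⟩, _, .inl ⟨f, hf, rfl⟩,
          h.map _ fun p g q e => .inl ⟨p, q, rfl, rfl, e⟩⟩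
      · exact ⟨_, .inr ⟨i, hi, rfl⟩, _, .inr ⟨f, hf, rfl⟩,
          h.map _ fun p g q e => .inr ⟨p, q, rfl, rfl, e⟩⟩
    · rintro ⟨i, hi, f, hf, h⟩
      rcases key _ _ _ h with ⟨p', q', rfl, rfl, h'⟩ | ⟨p', q', rfl, rfl, h'⟩
      · exact .inl ⟨p', by simpa using hi, q', by simpa using hf, h'⟩
      · exact .inr ⟨p', by simpa using hi, q', by simpa using hf, h'⟩

theorem IsAccepted.mul {A S T : Set M} (hA : 1 ∈ A) (hS : IsAccepted A S) (hT : IsAccepted A T) :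
    IsAccepted A (S * T) := by
  obtain ⟨Q₁, _, E₁, I₁, F₁, h₁, rfl⟩ := hS
  obtain ⟨Q₂, _, E₂, I₂, F₂, h₂, rfl⟩ := hT
  let E : Q₁ ⊕ Q₂ → M → Q₁ ⊕ Q₂ → Prop := fun p g q =>
    (∃ p' q', p = .inl p' ∧ q = .inl q' ∧ E₁ p' g q') ∨
    (∃ p' q', p = .inr p' ∧ q = .inr q' ∧ E₂ p' g q') ∨
    -- Silent edges glue the two automata; they are the reason for assuming `1 ∈ A`.
    (∃ p' ∈ F₁, ∃ q' ∈ I₂, p = .inl p' ∧ q = .inr q' ∧ g = 1)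
  have key : ∀ p g q, Reach E (.inl p) g q → (∃ q', q = .inl q' ∧ Reach E₁ p g q') ∨
      (∃ q', q = .inr q' ∧ ∃ f ∈ F₁, ∃ i ∈ I₂, ∃ g₁ g₂, g = g₁ * g₂ ∧
        Reach E₁ p g₁ f ∧ Reach E₂ i g₂ q') := by
    intro p g q h
    induction h with
    | refl => exact .inl ⟨p, rfl, .refl _⟩
    | tail _ e ih =>
      rcases ih with ⟨q', rfl, ih⟩ | ⟨q', rfl, f, hf, i, hi, g₁, g₂, rfl, r₁, r₂⟩
      · rcases e with ⟨p'', q'', hp, rfl, e⟩ | ⟨p'', q'', hp, rfl, e⟩ |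
          ⟨p'', hp', q'', hq', hp, rfl, rfl⟩ <;> cases hp
        · exact .inl ⟨_, rfl, ih.tail e⟩
        · exact .inr ⟨_, rfl, _, hp', _, hq', _, 1, rfl, ih, .refl _⟩
      · rcases e with ⟨p'', q'', hp, rfl, e⟩ | ⟨p'', q'', hp, rfl, e⟩ |
          ⟨p'', hp', q'', hq', hp, rfl, rfl⟩ <;> cases hp
        exact .inr ⟨_, rfl, f, hf, i, hi, g₁, _, mul_assoc _ _ _, r₁, r₂.tail e⟩
  refine ⟨Q₁ ⊕ Q₂, inferInstance, E, .inl '' I₁, .inr '' F₂, ?_, ?_⟩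
  · rintro p g q (⟨_, _, -, -, h⟩ | ⟨_, _, -, -, h⟩ | ⟨_, -, _, -, -, -, rfl⟩)
    exacts [h₁ _ _ _ h, h₂ _ _ _ h, hA]
  · ext g
    constructor
    · rintro ⟨g₁, ⟨i, hi, f, hf, h⟩, g₂, ⟨i', hi', f', hf', h'⟩, rfl⟩
      refine ⟨_, ⟨i, hi, rfl⟩, _, ⟨f', hf', rfl⟩, ?_⟩
      have r₁ : Reach E (.inl i) g₁ (.inl f) := h.map _ fun p g q e => .inl ⟨p, q, rfl, rfl, e⟩
      have r₂ : Reach E (.inr i') g₂ (.inr f') :=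
        h'.map _ fun p g q e => .inr (.inl ⟨p, q, rfl, rfl, e⟩)
      have r := (r₁.tail (h := 1) (.inr (.inr ⟨f, hf, i', hi', rfl, rfl, rfl⟩))).trans r₂
      simpa using r
    · rintro ⟨_, ⟨i, hi, rfl⟩, _, ⟨f, hf, rfl⟩, h⟩
      rcases key _ _ _ h with ⟨q', hq, -⟩ | ⟨q', hq, f', hf', i', hi', g₁, g₂, rfl, r₁, r₂⟩
      · cases hq
      · cases hq
        exact ⟨g₁, ⟨i, hi, f', hf', r₁⟩, g₂, ⟨i', hi', f, hf, r₂⟩, rfl⟩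

/-- A new state `none`, both initial and final, is joined by silent edges to the old initial states
and from the old final ones; each return to it completes a factor from `S`. -/
theorem IsAccepted.star {A S : Set M} (hA : 1 ∈ A) (hS : IsAccepted A S) :
    IsAccepted A (Submonoid.closure S : Set M) := by
  obtain ⟨Q, _, E₁, I, F, h₁, rfl⟩ := hS
  set S : Set M := {g | ∃ i ∈ I, ∃ f ∈ F, Reach E₁ i g f} with hS
  let E : Option Q → M → Option Q → Prop := fun p g q =>
    (∃ p' q', p = some p' ∧ q = some q' ∧ E₁ p' g q') ∨
    (∃ q' ∈ I, p = none ∧ q = some q' ∧ g = 1) ∨ (∃ p' ∈ F, p = some p' ∧ q = none ∧ g = 1)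
  have key : ∀ g q, Reach E none g q → (q = none ∧ g ∈ Submonoid.closure S) ∨
      ∃ q', q = some q' ∧ ∃ c ∈ Submonoid.closure S, ∃ i ∈ I, ∃ g', g = c * g' ∧
        Reach E₁ i g' q' := by
    intro g q h
    induction h with
    | refl => exact .inl ⟨rfl, one_mem _⟩
    | tail _ e ih =>
      rcases ih with ⟨rfl, ih⟩ | ⟨q', rfl, c, hc, i, hi, g', rfl, r⟩
      · rcases e with ⟨p'', q'', hp, rfl, e⟩ | ⟨q'', hq, hp, rfl, rfl⟩ |
          ⟨p'', hp', hp, rfl, rfl⟩ <;> cases hp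
        exact .inr ⟨_, rfl, _, ih, _, hq, 1, rfl, .refl _⟩
      · rcases e with ⟨p'', q'', hp, rfl, e⟩ | ⟨q'', hq, hp, rfl, rfl⟩ |
          ⟨p'', hp', hp, rfl, rfl⟩ <;> cases hp
        · exact .inr ⟨_, rfl, c, hc, i, hi, _, mul_assoc _ _ _, r.tail e⟩
        · rw [mul_one]
          exact .inl ⟨rfl, mul_mem hc (Submonoid.subset_closure ⟨i, hi, _, hp', r⟩)⟩
  refine ⟨Option Q, inferInstance, E, {none}, {none}, ?_, ?_⟩
  · rintro p g q (⟨_, _, -, -, h⟩ | ⟨_, -, -, -, rfl⟩ | ⟨_, -, -, -, rfl⟩)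
    exacts [h₁ _ _ _ h, hA, hA]
  · ext g
    simp only [Set.mem_singleton_iff, Set.mem_ofPred_eq, exists_eq_left, SetLike.mem_coe]
    constructor
    · intro hg
      induction hg using Submonoid.closure_induction with
      | one => exact .refl _
      | mul x y _ _ hx hy => exact hx.trans hy
      | mem x hx =>
        obtain ⟨i, hi, f, hf, r⟩ := hx
        have r₁ : Reach E (some i) x (some f) :=
          r.map _ fun p g q e => .inl ⟨p, q, rfl, rfl, e⟩
        have r₂ : Reach E none 1 (some i) := .single (.inr (.inl ⟨i, hi, rfl, rfl, rfl⟩))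
        have r₃ : Reach E (some f) 1 none := .single (.inr (.inr ⟨f, hf, rfl, rfl, rfl⟩))
        simpa using (r₂.trans r₁).trans r₃
    · intro h
      rcases key _ _ h with ⟨-, h⟩ | ⟨q', hq, -⟩
      · exact h
      · cases hq

theorem IsRationalSet.isAccepted {A S : Set M} (hA : 1 ∈ A) (hA' : Submonoid.closure A = ⊤)
    (hS : IsRationalSet S) : IsAccepted A S := by
  have single : ∀ g, IsAccepted A {g} := by
    intro g
    have hg : g ∈ Submonoid.closure A := hA' ▸ Submonoid.mem_top g
    induction hg using Submonoid.closure_induction with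
    | one => exact .singleton hA
    | mem x hx => exact .singleton hx
    | mul x y _ _ hx hy => simpa using hx.mul hA hy
  induction hS with
  | finite L hL =>
    induction L, hL using Set.Finite.induction_on with
    | empty => exact .empty A
    | insert _ _ ih => exact (single _).union ih
  | union K L _ _ hK hL => exact hK.union hL
  | mul K L _ _ hK hL => exact hK.mul hA hL
  | star L _ hL => exact hL.star hA

end Automata

theorem IsRationalSet.image {M N : Type*} [Monoid M] [Monoid N] (f : M →* N) {S : Set M}
    (hS : IsRationalSet S) : IsRationalSet (f '' S) := by
  induction hS with
  | finite L hL => exact .finite _ (hL.image f)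
  | union K L _ _ hK hL => rw [Set.image_union]; exact .union _ _ hK hL
  | mul K L _ _ hK hL => rw [Set.image_mul]; exact .mul _ _ hK hL
  | star L _ hL =>
    rw [← Submonoid.coe_map, MonoidHom.map_mclosure]
    exact .star _ hL

/-! ### Pumping in free groups -/

section Pumping

variable {α : Type*}

namespace FreeGroup

/-- The identity and the letters of a free group. -/
def shortElements (α : Type*) : Set (FreeGroup α) := {g | g = 1 ∨ ∃ a, g = mk [a]}

theorem closure_shortElements : Submonoid.closure (shortElements α) = ⊤ := by
  refine eq_top_iff.2 fun g _ => ?_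
  obtain ⟨L, rfl⟩ : ∃ L, mk L = g := Quot.exists_rep g
  induction L with
  | nil => exact one_mem _
  | cons a L ih =>
    rw [← List.singleton_append, ← mul_mk]
    exact mul_mem (Submonoid.subset_closure (.inr ⟨a, rfl⟩)) (ih trivial)

theorem mk_append_opposite (L : List (α × Bool)) {a b : α × Bool} (h₁ : b.1 = a.1)
    (h₂ : b.2 ≠ a.2) : mk (L ++ [b]) * mk [a] = mk L := by
  obtain ⟨a, s⟩ := a
  obtain ⟨b, t⟩ := b
  obtain rfl : b = a := h₁
  obtain rfl : s = !t := by cases s <;> cases t <;> simp_all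
  rw [mul_mk, List.append_assoc]
  exact Quot.sound (by simpa using Red.Step.not (L₁ := L) (L₂ := []) (x := b) (b := t))

theorem toWord_mul_letter [DecidableEq α] (z : FreeGroup α) (a : α × Bool) :
    (z * mk [a]).toWord = z.toWord ++ [a] ∨ (z * mk [a]).toWord <+: z.toWord := by
  by_cases h : IsReduced (z.toWord ++ [a])
  · left
    rw [← h.reduce_eq, ← toWord_mk, ← mul_mk, mk_toWord]
  · right
    rcases List.eq_nil_or_concat z.toWord with hz | ⟨L, b, hz⟩
    · simp [hz] at h
    · have hr : IsReduced (L ++ [b]) := by rw [← List.concat_eq_append, ← hz]; exact isReduced_toWord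
      have hab : ¬ (b.1 = a.1 → b.2 = a.2) := by
        intro hab
        apply h
        rw [hz, List.concat_eq_append]
        exact hr.append_overlap (L₃ := [a]) (by simpa using hab) (by simp)
      push Not at hab
      have hz' : z = mk (L ++ [b]) := by rw [← List.concat_eq_append, ← hz, mk_toWord]
      have hL : IsReduced L := hr.infix (List.prefix_append _ _).isInfix
      rw [hz', mk_append_opposite L hab.1 hab.2, toWord_mk, toWord_mk, hL.reduce_eq, hr.reduce_eq]
      exact List.prefix_append _ _

end FreeGroup

open FreeGroup

variable {Q : Type*} {E : Q → FreeGroup α → Q → Prop}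

/-- With short labels, each edge moves by at most one step in the Cayley tree, so a path from `1` to
`z` visits every vertex of the geodesic between them. -/
theorem Reach.split_prefix [DecidableEq α] (hE : ∀ p g q, E p g q → g ∈ shortElements α)
    {p r : Q} {z : FreeGroup α} (h : Reach E p z r) :
    ∀ u, u <+: z.toWord → ∃ s, Reach E p (mk u) s ∧ Reach E s ((mk u)⁻¹ * z) r := by
  induction h with
  | refl =>
    intro u hu
    obtain rfl : u = [] := by simpa using hu
    exact ⟨_, .refl _, by simpa [← one_eq_mk] using Reach.refl _⟩
  | @tail q r g h hp e ih =>
    intro u hu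
    have of_prefix : u <+: g.toWord → ∃ s, Reach E p (mk u) s ∧ Reach E s ((mk u)⁻¹ * (g * h)) r := by
      intro hu
      obtain ⟨s, h₁, h₂⟩ := ih u hu
      exact ⟨s, h₁, by rw [← mul_assoc]; exact h₂.tail e⟩
    rcases hE _ _ _ e with rfl | ⟨a, rfl⟩
    · exact of_prefix (by simpa using hu)
    · rcases toWord_mul_letter g a with hw | hw
      · rw [hw, List.prefix_concat_iff] at hu
        rcases hu with rfl | hu
        · have : mk (g.toWord ++ [a]) = g * mk [a] := by rw [← mul_mk, mk_toWord]
          refine ⟨r, ?_, ?_⟩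
          · rw [this]; exact hp.tail e
          · rw [this, inv_mul_cancel]; exact .refl _
        · exact of_prefix hu
      · exact of_prefix (hu.trans hw)

theorem reach_mk_append_iff (hE : ∀ p g q, E p g q → g ∈ shortElements α)
    {u v : List (α × Bool)} (huv : IsReduced (u ++ v)) {p r : Q} :
    Reach E p (mk (u ++ v)) r ↔ ∃ s, Reach E p (mk u) s ∧ Reach E s (mk v) r := by
  classical
  constructor
  · intro h
    obtain ⟨s, h₁, h₂⟩ := h.split_prefix hE u
      (by rw [toWord_mk, huv.reduce_eq]; exact List.prefix_append _ _)
    refine ⟨s, h₁, ?_⟩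
    rwa [← mul_mk, inv_mul_cancel_left] at h₂
  · rintro ⟨s, h₁, h₂⟩
    rw [← mul_mk]
    exact h₁.trans h₂

theorem isReduced_replicate (n : ℕ) (a : α × Bool) : IsReduced (List.replicate n a) :=
  List.isChain_replicate_of_rel _ fun _ => rfl

/-- Pumping for reduced words: in a rational subset of a free group, suitable powers of a letter
may be lengthened. -/
theorem IsRationalSet.pumping {S : Set (FreeGroup α)} (hS : IsRationalSet S) (a : α × Bool) :
    ∃ m k : ℕ, 0 < m ∧ 0 < k ∧ ∀ (t : ℕ) (u v : List (α × Bool)),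
      IsReduced (u ++ (List.replicate m a ++ v)) →
      IsReduced (u ++ (List.replicate (m + k * t) a ++ v)) →
      mk (u ++ (List.replicate m a ++ v)) ∈ S →
      mk (u ++ (List.replicate (m + k * t) a ++ v)) ∈ S := by
  obtain ⟨Q, _, E, I, F, hE, rfl⟩ := hS.isAccepted (A := shortElements α) (.inl rfl)
    closure_shortElements
  -- The automaton sees a power of `a` only through the relation it induces on states. There are
  -- finitely many relations, so two powers agree; the shift `n + 1` keeps the exponent positive.
  obtain ⟨m, n, hmn, h⟩ := Finite.exists_ne_map_eq_of_infinite
    fun (n : ℕ) (p q : Q) => Reach E p (mk (List.replicate (n + 1) a)) q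
  wlog hlt : m < n generalizing m n
  · exact this n m hmn.symm h.symm (by omega)
  have h : ∀ p q, Reach E p (mk (List.replicate (m + 1) a)) q ↔
      Reach E p (mk (List.replicate (m + 1 + (n - m)) a)) q := by
    intro p q
    rw [show m + 1 + (n - m) = n + 1 by omega]
    exact iff_of_eq (congrFun (congrFun h p) q)
  have pump : ∀ t p q, Reach E p (mk (List.replicate (m + 1) a)) q ↔
      Reach E p (mk (List.replicate (m + 1 + (n - m) * t) a)) q := by
    intro t
    induction t with
    | zero => simp
    | succ t ih =>
      intro p q
      rw [ih, show m + 1 + (n - m) * (t + 1) = (m + 1 + (n - m)) + (n - m) * t by ring,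
        List.replicate_add, List.replicate_add (m := m + 1 + (n - m)), reach_mk_append_iff hE,
        reach_mk_append_iff hE]
      · simp only [h]
      · rw [← List.replicate_add]; exact isReduced_replicate _ _
      · rw [← List.replicate_add]; exact isReduced_replicate _ _
  refine ⟨m + 1, n - m, by omega, by omega, ?_⟩
  rintro t u v hr hr' ⟨i, hi, f, hf, h⟩
  refine ⟨i, hi, f, hf, ?_⟩
  rw [reach_mk_append_iff hE hr] at h
  rw [reach_mk_append_iff hE hr']
  obtain ⟨s, h₁, h⟩ := h
  rw [reach_mk_append_iff hE (hr.infix (List.suffix_append _ _).isInfix)] at h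
  refine ⟨s, h₁, ?_⟩
  rw [reach_mk_append_iff hE (hr'.infix (List.suffix_append _ _).isInfix)]
  obtain ⟨s', h₂, h₃⟩ := h
  exact ⟨s', (pump t _ _).1 h₂, h₃⟩

end Pumping

open FreeGroup

/-! ### Counting runs of a letter -/

section RunCount

/-- The signed indicator of `n = ± m`. -/
def signedIndicator (m : ℕ) (n : ℤ) : ℤ := if n = m then 1 else if n = -m then -1 else 0

theorem signedIndicator_neg {m : ℕ} (hm : 0 < m) (n : ℤ) :
    signedIndicator m (-n) = -signedIndicator m n := by
  unfold signedIndicator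
  grind

theorem signedIndicator_zero {m : ℕ} (hm : 0 < m) : signedIndicator m 0 = 0 := by
  unfold signedIndicator
  grind

theorem signedIndicator_of_ne {m : ℕ} {n : ℤ} (h : n.natAbs ≠ m) : signedIndicator m n = 0 := by
  unfold signedIndicator
  grind

/-- The exponent of the run of the letter `0` at the start of a word. -/
def firstRun : List (Fin 2 × Bool) → ℤ
  | [] => 0
  | (0, b) :: L => (if b then 1 else -1) + firstRun L
  | (1, _) :: _ => 0

/-- The signed number of runs of the letter `0` with exponent `± m`, without the first run. -/
def laterRuns (m : ℕ) : List (Fin 2 × Bool) → ℤ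
  | [] => 0
  | (0, _) :: L => laterRuns m L
  | (1, _) :: L => signedIndicator m (firstRun L) + laterRuns m L

/-- The signed number of runs of the letter `0` with exponent `± m`. -/
def runCount (m : ℕ) (L : List (Fin 2 × Bool)) : ℤ :=
  signedIndicator m (firstRun L) + laterRuns m L

/-- Only the first runs of `L` and `K` meet at the junction, merging into one run; the other runs of
`L` are inverted. No reducedness is needed, since exponents just add. -/
theorem runCount_invRev_append {m : ℕ} (hm : 0 < m) (L K : List (Fin 2 × Bool)) :
    runCount m (invRev L ++ K) =
      -laterRuns m L + signedIndicator m (firstRun K - firstRun L) + laterRuns m K := by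
  induction L generalizing K with
  | nil => simp [runCount, firstRun, laterRuns]
  | cons a L ih =>
    obtain ⟨i, b⟩ := a
    have h : invRev ((i, b) :: L) ++ K = invRev L ++ (i, !b) :: K := by simp [invRev]
    rw [h, ih]
    fin_cases i
    · have : (if (!b) = true then (1 : ℤ) else -1) + firstRun K - firstRun L =
          firstRun K - ((if b = true then (1 : ℤ) else -1) + firstRun L) := by
        cases b <;> simp <;> ring
      simp only [laterRuns, firstRun, this]
    · simp only [laterRuns, firstRun, zero_sub, sub_zero, signedIndicator_neg hm]
      ring

theorem runCount_invRev {m : ℕ} (hm : 0 < m) (L : List (Fin 2 × Bool)) :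
    runCount m (invRev L) = -runCount m L := by
  have h := runCount_invRev_append hm L []
  simp only [List.append_nil, firstRun, laterRuns, zero_sub, signedIndicator_neg hm] at h
  rw [h, runCount]
  ring

theorem FreeGroup.exists_cancellation {α : Type*} (L₁ L₂ : List (α × Bool)) (h₁ : IsReduced L₁)
    (h₂ : IsReduced L₂) :
    ∃ A B C, L₁ = A ++ C ∧ L₂ = invRev C ++ B ∧ IsReduced (A ++ B) := by
  induction L₁ using List.reverseRecOn generalizing L₂ with
  | nil => exact ⟨[], L₂, [], rfl, by simp, by simpa using h₂⟩
  | append_singleton L a ih =>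
    rcases L₂ with - | ⟨b, K⟩
    · exact ⟨L ++ [a], [], [], by simp, by simp, by simpa using h₁⟩
    · by_cases hab : a.1 = b.1 → a.2 = b.2
      · refine ⟨L ++ [a], b :: K, [], by simp, by simp, ?_⟩
        refine h₁.append_overlap (L₃ := b :: K) ?_ (by simp)
        exact isReduced_cons_cons.2 ⟨hab, h₂⟩
      · obtain ⟨A, B, C, rfl, rfl, h⟩ := ih K (h₁.infix (List.prefix_append _ _).isInfix)
          (h₂.infix (List.suffix_cons _ _).isInfix)
        refine ⟨A, B, C ++ [a], by simp, ?_, h⟩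
        obtain ⟨a, s⟩ := a
        obtain ⟨b, t⟩ := b
        push Not at hab
        obtain ⟨rfl, hst⟩ := hab
        obtain rfl : t = !s := by cases s <;> cases t <;> simp_all
        simp [invRev]

/-- Write `g = A⁻¹C`, `h = C⁻¹B`, `gh = A⁻¹B` without cancellation. The later runs of `A`, `B`, `C`
balance, so only the runs across the three junctions can spoil additivity. -/
theorem exists_runCount_mul (g h : FreeGroup (Fin 2)) :
    ∃ B : Finset ℕ, B.card ≤ 3 ∧ ∀ m, 0 < m → m ∉ B →
      runCount m (g * h).toWord = runCount m g.toWord + runCount m h.toWord := by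
  obtain ⟨A, B, C, h₁, h₂, h₃⟩ :=
    exists_cancellation g.toWord h.toWord isReduced_toWord isReduced_toWord
  have hgh : (g * h).toWord = A ++ B := by
    have : g * h = mk (A ++ B) := by
      rw [← mk_toWord (x := g), ← mk_toWord (x := h), h₁, h₂, ← mul_mk, ← mul_mk, ← mul_mk,
        ← inv_mk]
      group
    rw [this, toWord_mk, h₃.reduce_eq]
  obtain ⟨A, rfl⟩ : ∃ A', A = invRev A' := ⟨invRev A, by simp⟩
  refine ⟨{(firstRun B - firstRun A).natAbs, (firstRun C - firstRun A).natAbs,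
    (firstRun B - firstRun C).natAbs}, Finset.card_le_three, fun m hm hmB => ?_⟩
  simp only [Finset.mem_insert, Finset.mem_singleton, not_or] at hmB
  rw [hgh, h₁, h₂, runCount_invRev_append hm, runCount_invRev_append hm, runCount_invRev_append hm,
    signedIndicator_of_ne (Ne.symm hmB.1), signedIndicator_of_ne (Ne.symm hmB.2.1),
    signedIndicator_of_ne (Ne.symm hmB.2.2)]
  ring

/-- Up to few exceptional `m`, counting runs of exponent `m` commutes with evaluating a word. -/
theorem exists_runCount_lift {ι : Type*} (a : ι → FreeGroup (Fin 2)) (L : List (ι × Bool)) :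
    ∃ B : Finset ℕ, B.card ≤ 3 * L.length ∧ ∀ m, 0 < m → m ∉ B →
      Multiplicative.ofAdd (runCount m (lift a (mk L)).toWord) =
        lift (fun i => Multiplicative.ofAdd (runCount m (a i).toWord)) (mk L) := by
  induction L with
  | nil =>
    refine ⟨∅, by simp, fun m hm _ => ?_⟩
    simp [← one_eq_mk, runCount, firstRun, laterRuns, signedIndicator_zero hm]
  | cons s L ih =>
    obtain ⟨B, hB, h⟩ := ih
    obtain ⟨B', hB', h'⟩ := exists_runCount_mul (lift a (mk [s])) (lift a (mk L))
    refine ⟨B ∪ B', (Finset.card_union_le _ _).trans ?_, fun m hm hmB => ?_⟩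
    · simp only [List.length_cons]
      omega
    · simp only [Finset.mem_union, not_or] at hmB
      have hs : mk (s :: L) = mk [s] * mk L := by rw [mul_mk, List.singleton_append]
      rw [hs, _root_.map_mul, _root_.map_mul, h' m hm hmB.2, ofAdd_add, h m hm hmB.1]
      congr 1
      obtain ⟨i, b⟩ := s
      cases b <;> simp [toWord_inv, runCount_invRev hm]

theorem runCount_replicate_append (m n : ℕ) (L : List (Fin 2 × Bool)) :
    runCount m (List.replicate n (0, true) ++ (1, true) :: L) =
      signedIndicator m n + runCount m L := by
  have h₁ : firstRun (List.replicate n (0, true) ++ (1, true) :: L) = n := by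
    induction n with
    | zero => rfl
    | succ n ih =>
      rw [List.replicate_succ, List.cons_append, firstRun, ih]
      push_cast
      simp [add_comm]
  have h₂ : laterRuns m (List.replicate n (0, true) ++ (1, true) :: L) =
      laterRuns m ((1, true) :: L) := by
    clear h₁
    induction n with
    | zero => rfl
    | succ n ih => rw [List.replicate_succ, List.cons_append, laterRuns, ih]
  rw [runCount, h₁, h₂, laterRuns, runCount]

/-- The positive word whose runs of the letter `0` have the prescribed lengths. -/
def runWord (l : List ℕ) : List (Fin 2 × Bool) :=
  l.flatMap fun n => List.replicate n (0, true) ++ [(1, true)]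

theorem runWord_cons (n : ℕ) (l : List ℕ) :
    runWord (n :: l) = List.replicate n (0, true) ++ (1, true) :: runWord l := by
  simp [runWord]

theorem runCount_runWord {m : ℕ} (hm : 0 < m) (l : List ℕ) :
    runCount m (runWord l) = l.count m := by
  induction l with
  | nil => simp [runWord, runCount, firstRun, laterRuns, signedIndicator_zero hm]
  | cons n l ih =>
    rw [runWord_cons, runCount_replicate_append, ih, List.count_cons, signedIndicator]
    have : (n : ℤ) ≠ -m := by omega
    by_cases h : n = m <;> simp [h, this, add_comm]

end RunCount

/-! ### Positive words with distinct runs -/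

section PositiveWords

variable {α : Type*}

theorem isReduced_of_positive {L : List (α × Bool)} (h : ∀ a ∈ L, a.2 = true) : IsReduced L := by
  induction L with
  | nil => exact IsReduced.nil
  | cons a L ih =>
    rcases L with - | ⟨b, L⟩
    · exact IsReduced.singleton
    · refine isReduced_cons_cons.2 ⟨fun _ => ?_, ih fun c hc => h c (List.mem_cons_of_mem _ hc)⟩
      rw [h a (by simp), h b (by simp)]

theorem positive_runWord (l : List ℕ) : ∀ a ∈ runWord l, a.2 = true := by
  intro a ha
  simp only [runWord, List.mem_flatMap, List.mem_append, List.mem_replicate,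
    List.mem_singleton] at ha
  obtain ⟨n, -, ⟨-, rfl⟩ | rfl⟩ := ha <;> rfl

end PositiveWords

/-- A rational set that contains the powers of `xᵐy` contains words with many distinct runs. -/
theorem IsRationalSet.exists_runWord_mem {S : Set (FreeGroup (Fin 2))} (hS : IsRationalSet S) :
    ∃ m k : ℕ, 0 < m ∧ 0 < k ∧ ∀ s : ℕ, mk (runWord (List.replicate s m)) ∈ S →
      mk (runWord ((List.range s).map fun i => m + k * i)) ∈ S := by
  obtain ⟨m, k, hm, hk, h⟩ := hS.pumping ((0, true) : Fin 2 × Bool)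
  refine ⟨m, k, hm, hk, fun s hs => ?_⟩
  -- The runs are pumped from left to right, `u` holding those already done; the same `m`, `k` serve
  -- throughout, and positivity keeps every word reduced.
  have key : ∀ (l : List ℕ) (u : List (Fin 2 × Bool)), (∀ a ∈ u, a.2 = true) →
      mk (u ++ runWord (List.replicate l.length m)) ∈ S →
      mk (u ++ runWord (l.map fun i => m + k * i)) ∈ S := by
    intro l
    induction l with
    | nil => exact fun u _ hu => hu
    | cons t l ih =>
      intro u hu hmem
      have pos : ∀ n r, ∀ a ∈ u ++ (List.replicate n (0, true) ++ (1, true) :: runWord r),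
          a.2 = true := by
        intro n r a ha
        rw [← runWord_cons, List.mem_append] at ha
        exact ha.elim (hu a) (positive_runWord _ a)
      rw [List.length_cons, List.replicate_succ, runWord_cons] at hmem
      have h' := h t u _ (isReduced_of_positive (pos _ _)) (isReduced_of_positive (pos _ _)) hmem
      have := ih (u ++ (List.replicate (m + k * t) (0, true) ++ [(1, true)])) ?_ ?_
      · rw [List.map_cons, runWord_cons]
        simpa using this
      · intro a ha
        refine pos (m + k * t) [] a ?_
        simpa [runWord] using ha
      · simpa using h'
  simpa using key (List.range s) [] (by simp) (by simpa using hs)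

theorem mk_runWord_replicate (s m : ℕ) :
    mk (runWord (List.replicate s m)) = mk (runWord [m]) ^ s := by
  induction s with
  | zero => rfl
  | succ s ih =>
    rw [List.replicate_succ, pow_succ', ← ih, mul_mk]
    simp [runWord]

/-! ### Sets that vanish in the abelianization -/

section PowerEndomorphism

variable {α : Type*}

theorem FreeGroup.mk_replicate (n : ℕ) (a : α × Bool) : mk (List.replicate n a) = mk [a] ^ n := by
  induction n with
  | zero => rfl
  | succ n ih => rw [List.replicate_succ, pow_succ', ← ih, mul_mk, List.singleton_append]

theorem FreeGroup.lift_pow_mk (n : ℕ) (L : List (α × Bool)) :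
    lift (fun i => (of i : FreeGroup α) ^ n) (mk L) = mk (L.flatMap (List.replicate n)) := by
  induction L with
  | nil => rfl
  | cons a L ih =>
    rw [← List.singleton_append, ← mul_mk, _root_.map_mul, ih, List.flatMap_append, ← mul_mk]
    congr 1
    obtain ⟨i, b⟩ := a
    rw [List.flatMap_singleton, mk_replicate]
    cases b
    · have : (mk [(i, false)] : FreeGroup α) = (of i)⁻¹ := rfl
      rw [this, _root_.map_inv, lift_apply_of, inv_pow]
    · have : (mk [(i, true)] : FreeGroup α) = of i := rfl
      rw [this, lift_apply_of]

theorem FreeGroup.IsReduced.flatMap_replicate {L : List (α × Bool)} (hL : IsReduced L) {n : ℕ}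
    (hn : n ≠ 0) : IsReduced (L.flatMap (List.replicate n)) := by
  rw [IsReduced, List.flatMap_def, List.isChain_flatten (by simp [hn])]
  refine ⟨fun l hl => ?_, ?_⟩
  · obtain ⟨a, -, rfl⟩ := List.mem_map.1 hl
    exact isReduced_replicate n a
  rw [List.isChain_map]
  refine hL.imp fun a b hab => ?_
  simpa [List.getLast?_replicate, List.head?_replicate, hn] using hab

/-- A nontrivial set of elements of a free group that is closed under endomorphisms and has trivial
image in the abelianization is not rational. -/
theorem not_isRationalSet_of_hom_int_eq_one {S : Set (FreeGroup α)}
    (hend : ∀ f : FreeGroup α →* FreeGroup α, ∀ g ∈ S, f g ∈ S)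
    (hab : ∀ f : FreeGroup α →* Multiplicative ℤ, ∀ g ∈ S, f g = 1)
    {g : FreeGroup α} (hg : g ∈ S) (hg1 : g ≠ 1) : ¬ IsRationalSet S := by
  classical
  intro hS
  obtain ⟨a, L, hL⟩ : ∃ a L, g.toWord = a :: L :=
    List.exists_cons_of_ne_nil (by rwa [Ne, toWord_eq_nil_iff])
  obtain ⟨m, k, hm, hk, h⟩ := hS.pumping a
  have hr : IsReduced (List.replicate m a ++ L.flatMap (List.replicate m)) := by
    have := (isReduced_toWord (x := g)).flatMap_replicate hm.ne'
    rwa [hL, List.flatMap_cons] at this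
  have hr' : IsReduced (List.replicate (m + k * 1) a ++ L.flatMap (List.replicate m)) := by
    rw [add_comm, List.replicate_add]
    refine IsReduced.append_overlap ?_ hr (by simp [hm.ne'])
    rw [← List.replicate_add]
    exact isReduced_replicate _ _
  have hmem : mk (List.replicate m a ++ L.flatMap (List.replicate m)) ∈ S := by
    have := hend (lift fun i => (of i : FreeGroup α) ^ m) g hg
    rwa [← mk_toWord (x := g), lift_pow_mk, hL, List.flatMap_cons] at this
  have hmem' := h 1 [] _ hr hr' hmem
  -- The exponent sums of the two words differ by `± k`, so they cannot both vanish.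
  let f : FreeGroup α →* Multiplicative ℤ := lift fun _ => Multiplicative.ofAdd 1
  have e := hab f _ hmem
  have e' := hab f _ hmem'
  rw [List.nil_append, ← mul_mk, _root_.map_mul, mk_replicate, map_pow] at e'
  rw [← mul_mk, _root_.map_mul, mk_replicate, map_pow] at e
  rw [mul_one, pow_add, mul_right_comm, e, one_mul] at e'
  obtain ⟨i, b⟩ := a
  have e'' := congrArg Multiplicative.toAdd e'
  cases b <;> simp [f, hk.ne'] at e''

end PowerEndomorphism

/-! ### Embedding a free group of countable rank in $F_2$ -/

section Embedding

/-- The action of `ℤ` on the free group with basis `ℤ` by translating the basis. -/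
def FreeGroup.shift : Multiplicative ℤ →* MulAut (FreeGroup ℤ) where
  toFun n := freeGroupCongr (Equiv.addLeft n.toAdd)
  map_one' := by
    apply MulEquiv.toMonoidHom_injective
    ext i
    simp
  map_mul' m n := by
    apply MulEquiv.toMonoidHom_injective
    ext i
    simp [add_assoc]

/-- The conjugates $y^ixy^{-i}$ are free: in the semidirect product by the shift, with $y$ acting as
translation, they become distinct basis elements. -/
theorem FreeGroup.exists_injective_hom_fin_two :
    ∃ f : FreeGroup ℕ →* FreeGroup (Fin 2), Function.Injective f := by
  let a : ℕ → FreeGroup (Fin 2) := fun i => of 1 ^ i * of 0 * (of 1 ^ i)⁻¹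
  let θ : FreeGroup (Fin 2) →* FreeGroup ℤ ⋊[shift] Multiplicative ℤ :=
    lift ![SemidirectProduct.inl (of 0), SemidirectProduct.inr (Multiplicative.ofAdd 1)]
  have h : θ.comp (lift a) = SemidirectProduct.inl.comp (FreeGroup.map ((↑) : ℕ → ℤ)) := by
    ext i : 1
    have : θ (a i) = SemidirectProduct.inl (shift (Multiplicative.ofAdd (i : ℤ)) (of 0)) := by
      rw [SemidirectProduct.inl_aut, _root_.map_inv]
      have : Multiplicative.ofAdd (i : ℤ) = Multiplicative.ofAdd (1 : ℤ) ^ i := by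
        rw [← ofAdd_nsmul]; simp
      rw [this, map_pow]
      simp [θ, a]
    change θ (lift a (of i)) = SemidirectProduct.inl (FreeGroup.map _ (of i))
    rw [lift_apply_of, this, FreeGroup.map.of]
    simp [shift]
  refine ⟨lift a, fun x y hxy => ?_⟩
  have h' : θ.comp (lift a) x = θ.comp (lift a) y := congrArg θ hxy
  rw [h] at h'
  exact FreeGroup.map_injective Nat.cast_injective (SemidirectProduct.inl_injective h')

end Embedding

/-! ### Verbal sets of proper words -/

section VerbalSets

theorem map_mem_verbalSet {w : FreeGroup ℕ} {G H : Type*} [Group G] [Group H] (f : G →* H) {g : G}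
    (hg : g ∈ verbalSet w G) : f g ∈ verbalSet w H := by
  obtain ⟨a, rfl⟩ := hg
  refine ⟨f ∘ a, ?_⟩
  have : lift (f ∘ a) = f.comp (lift a) := by ext; simp
  rw [this]; rfl

theorem image_verbalSet {w : FreeGroup ℕ} {G H : Type*} [Group G] [Group H] {f : G →* H}
    (hf : Function.Surjective f) : f '' verbalSet w G = verbalSet w H := by
  refine Set.Subset.antisymm (Set.image_subset_iff.2 fun g hg => map_mem_verbalSet f hg) ?_
  rintro _ ⟨a, rfl⟩
  choose b hb using fun i => hf (a i)
  refine ⟨lift b w, ⟨b, rfl⟩, ?_⟩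
  have : f.comp (lift b) = lift a := by ext; simp [hb]
  rw [← this]; rfl

theorem IsProperWord.ne_one {w : FreeGroup ℕ} (hw : IsProperWord.{p, q} w) : w ≠ 1 := by
  rintro rfl
  obtain ⟨G, _, hG⟩ := hw.1
  exact hG (by ext; simp only [verbalSet, _root_.map_one, exists_const, Set.mem_ofPred_eq, Set.mem_singleton_iff, eq_comm])

/-- If `w` took the value $1$ in $\mathbb Z$, the maps $1\mapsto g$ would make every element of
every group a value. -/
theorem IsProperWord.ofAdd_one_notMem {w : FreeGroup ℕ} (hw : IsProperWord.{p, q} w) :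
    Multiplicative.ofAdd 1 ∉ verbalSet w (Multiplicative ℤ) := by
  intro h
  obtain ⟨H, _, hH⟩ := hw.2
  refine hH (Set.eq_univ_of_forall fun g => ?_)
  simpa using map_mem_verbalSet (zpowersHom H g) h

/-- The verbal set of a proper word in a free group of rank two is not rational. -/
theorem IsProperWord.not_isRationalSet_verbalSet {w : FreeGroup ℕ} (hw : IsProperWord.{p, q} w) :
    ¬ IsRationalSet (verbalSet w (FreeGroup (Fin 2))) := by
  by_cases h0 : ∀ c ∈ verbalSet w (Multiplicative ℤ), c = 1
  · obtain ⟨f, hf⟩ := exists_injective_hom_fin_two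
    refine not_isRationalSet_of_hom_int_eq_one (fun f g hg => map_mem_verbalSet f hg)
      (fun f g hg => h0 _ (map_mem_verbalSet f hg)) (g := f w) (map_mem_verbalSet f ?_) ?_
    · exact ⟨of, lift_of_apply w⟩
    · rw [Ne, map_eq_one_iff f hf]
      exact hw.ne_one
  · push Not at h0
    intro hS
    have zpow_mem : ∀ c ∈ verbalSet w (Multiplicative ℤ), ∀ n : ℤ,
        c ^ n ∈ verbalSet w (Multiplicative ℤ) := fun c hc n =>
      map_mem_verbalSet (zpowGroupHom n) hc
    obtain ⟨d, hd, hd'⟩ : ∃ d : ℕ, 0 < d ∧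
        Multiplicative.ofAdd (d : ℤ) ∈ verbalSet w (Multiplicative ℤ) := by
      obtain ⟨c, hc, hc1⟩ := h0
      have hc0 : c.toAdd ≠ 0 := hc1
      refine ⟨c.toAdd.natAbs, Int.natAbs_pos.2 hc0, ?_⟩
      rcases Int.natAbs_eq c.toAdd with h | h
      · rw [← h]; exact hc
      · have := zpow_mem c hc (-1)
        rw [eq_neg_iff_add_eq_zero, add_comm, ← eq_neg_iff_add_eq_zero] at h
        rw [h]
        simpa using this
    obtain ⟨m, k, hm, hk, h⟩ := hS.exists_runWord_mem
    have hpow : ∀ s, mk (runWord (List.replicate (d * s) m)) ∈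
        verbalSet w (FreeGroup (Fin 2)) := by
      intro s
      rw [mk_runWord_replicate, mul_comm, pow_mul]
      have := map_mem_verbalSet (zpowersHom _ (mk (runWord [m]) ^ s)) hd'
      simpa using this
    -- One more than the bound on the number of exceptional exponents; the factor `d ≥ 1` only adds
    -- runs.
    obtain ⟨a, ha⟩ := h _ (hpow (3 * w.toWord.length + 1))
    obtain ⟨B, hB, hB'⟩ := exists_runCount_lift a w.toWord
    set s := d * (3 * w.toWord.length + 1) with hs
    have hlt : B.card < ((Finset.range s).image fun i => m + k * i).card := by
      rw [Finset.card_image_of_injective, Finset.card_range]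
      · nlinarith
      · intro i j hij
        simpa [hk.ne'] using hij
    obtain ⟨n, hn, hnB⟩ := Finset.exists_mem_notMem_of_card_lt_card hlt
    obtain ⟨i, hi, rfl⟩ := Finset.mem_image.1 hn
    have hpos : 0 < m + k * i := by omega
    have key := hB' _ hpos hnB
    rw [mk_toWord, ha, toWord_mk,
      (isReduced_of_positive (positive_runWord _)).reduce_eq, runCount_runWord hpos] at key
    have hcount : ((List.range s).map fun i => m + k * i).count (m + k * i) = 1 := by
      refine List.count_eq_one_of_mem ?_ (List.mem_map_of_mem (List.mem_range.2 ?_))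
      · refine List.Nodup.map ?_ List.nodup_range
        intro i j hij
        simpa [hk.ne'] using hij
      · exact Finset.mem_range.1 hi
    rw [hcount] at key
    exact hw.ofAdd_one_notMem ⟨_, key.symm⟩

theorem not_isRationalSet_verbalSet_of_surjective {G : Type*} [Group G]
    {f : G →* FreeGroup (Fin 2)} (hf : Function.Surjective f) {w : FreeGroup ℕ}
    (hw : IsProperWord.{p, q} w) : ¬ IsRationalSet (verbalSet w G) := fun h =>
  hw.not_isRationalSet_verbalSet (image_verbalSet (w := w) hf ▸ h.image f)

end VerbalSets

/-! ### Maps onto $F_2$: right-angled Artin and residually free groups -/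

section Quotients

theorem surjective_of_mem_range {G : Type*} [Group G] {f : G →* FreeGroup (Fin 2)}
    (h₀ : of 0 ∈ f.range) (h₁ : of 1 ∈ f.range) : Function.Surjective f := by
  rw [← MonoidHom.range_eq_top, eq_top_iff, ← closure_range_of, Subgroup.closure_le]
  rintro _ ⟨i, rfl⟩
  fin_cases i
  exacts [h₀, h₁]

theorem commute_of_closure_range_eq_top {ι G : Type*} [Group G] {f : ι → G}
    (hf : Subgroup.closure (Set.range f) = ⊤) (h : ∀ i j, f i * f j = f j * f i) (a b : G) :
    a * b = b * a := by
  have comm : ∀ (x : G), (∀ i, f i * x = x * f i) → ∀ y, y * x = x * y := by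
    intro x hx y
    have : Subgroup.closure (Set.range f) ≤ Subgroup.centralizer {x} := by
      rw [Subgroup.closure_le]
      rintro _ ⟨i, rfl⟩
      exact Subgroup.mem_centralizer_singleton_iff.2 (hx i)
    rw [hf] at this
    exact Subgroup.mem_centralizer_singleton_iff.1 (this (Subgroup.mem_top y))
  exact comm b (fun i => (comm (f i) (fun j => h j i) b).symm) a

theorem RightAngledArtinGroup.exists_surjective {V : Type*} (Γ : SimpleGraph V)
    (h : ¬ ∀ a b : RightAngledArtinGroup Γ, a * b = b * a) :
    ∃ f : RightAngledArtinGroup Γ →* FreeGroup (Fin 2), Function.Surjective f := by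
  classical
  obtain ⟨x, y, hxy, hadj⟩ : ∃ x y : V, x ≠ y ∧ ¬ Γ.Adj x y := by
    by_contra! hc
    refine h (commute_of_closure_range_eq_top (PresentedGroup.closure_range_of _) fun i j => ?_)
    by_cases hij : i = j
    · rw [hij]
    · have := PresentedGroup.one_of_mem (rels := {r : FreeGroup V | ∃ u v : V, Γ.Adj u v ∧
        r = of u * of v * (of v * of u)⁻¹}) ⟨i, j, hc i j hij, rfl⟩
      rwa [_root_.map_mul, _root_.map_inv, mul_inv_eq_one, _root_.map_mul, _root_.map_mul] at this
  let g : V → FreeGroup (Fin 2) := fun z => if z = x then of 0 else if z = y then of 1 else 1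
  have hg : ∀ r ∈ {r : FreeGroup V | ∃ u v : V, Γ.Adj u v ∧
      r = of u * of v * (of v * of u)⁻¹}, lift g r = 1 := by
    rintro _ ⟨u, v, huv, rfl⟩
    have hne := huv.ne
    simp only [_root_.map_mul, _root_.map_inv, lift_apply_of, mul_inv_eq_one, g]
    split_ifs <;> subst_vars <;> first | simp | exact absurd huv hadj | exact absurd huv.symm hadj
  refine ⟨PresentedGroup.toGroup hg, surjective_of_mem_range ⟨.of x, ?_⟩ ⟨.of y, ?_⟩⟩
  · rw [PresentedGroup.toGroup.of]
    simp [g]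
  · rw [PresentedGroup.toGroup.of]
    simp [g, hxy.symm]

theorem FreeGroup.exists_surjective_of_ne {X : Type*} {x y : X} (hxy : x ≠ y) :
    ∃ f : FreeGroup X →* FreeGroup (Fin 2), Function.Surjective f := by
  classical
  refine ⟨lift fun z => if z = x then of 0 else if z = y then of 1 else 1,
    surjective_of_mem_range ⟨of x, ?_⟩ ⟨of y, ?_⟩⟩
  · simp
  · simp [hxy.symm]

theorem IsResiduallyFree.exists_surjective {H : Type v} [Group H] (hH : IsResiduallyFree H)
    (h : ¬ ∀ a b : H, a * b = b * a) :
    ∃ f : H →* FreeGroup (Fin 2), Function.Surjective f := by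
  push Not at h
  obtain ⟨a, b, hab⟩ := h
  obtain ⟨ι, φ, hφ⟩ := hH (a * b * (b * a)⁻¹) (mul_inv_eq_one.not.2 hab)
  -- By Nielsen–Schreier the image is free; `a` and `b` do not commute in it, so its basis has two
  -- distinct elements.
  let e := IsFreeGroup.toFreeGroup φ.range
  have hne : ∃ x y : IsFreeGroup.Generators φ.range, x ≠ y := by
    by_contra! hc
    apply hφ
    have hcomm := commute_of_closure_range_eq_top
      (closure_range_of (IsFreeGroup.Generators φ.range)) (fun i j => by rw [hc i j])
      (e (φ.rangeRestrict a)) (e (φ.rangeRestrict b))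
    rw [← _root_.map_mul, ← _root_.map_mul, ← _root_.map_mul, ← _root_.map_mul, e.injective.eq_iff] at hcomm
    have := congrArg Subtype.val hcomm
    rw [_root_.map_mul, _root_.map_inv, mul_inv_eq_one]
    exact this
  obtain ⟨x, y, hxy⟩ := hne
  obtain ⟨f, hf⟩ := FreeGroup.exists_surjective_of_ne hxy
  exact ⟨f.comp (e.toMonoidHom.comp φ.rangeRestrict),
    hf.comp (e.surjective.comp φ.rangeRestrict_surjective)⟩

end Quotients

/-! ### Maps onto $F_2$: pure braid groups -/

section PureBraids

/-- The transposition of `i` and `i + 1`. -/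
def natSwap (i x : ℕ) : ℕ := if x = i then i + 1 else if x = i + 1 then i else x

/-- The contribution of the generator `σᵢ` of the braid group to the map that forgets all strands
but those at `x`, `y`, `z`, and then kills the center of the pure braid group on three strands. -/
def strandCocycle (i x y z : ℕ) : FreeGroup (Fin 2) :=
  if y = i ∧ x = i + 1 then of 0
  else if z = i ∧ y = i + 1 then of 1
  -- Killing the center forces the product of the three pairwise twists to be trivial; the side on
  -- which `y` stands decides between two conjugate forms.
  else if z = i ∧ x = i + 1 then
    if i + 1 < y then (of 0)⁻¹ * (of 1)⁻¹ else (of 1)⁻¹ * (of 0)⁻¹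
  else 1

theorem strandCocycle_natSwap {i j : ℕ} (h : i + 2 ≤ j ∨ j + 2 ≤ i) (x y z : ℕ) :
    strandCocycle i (natSwap j x) (natSwap j y) (natSwap j z) = strandCocycle i x y z := by
  have h₁ : ∀ t, natSwap j t = i ↔ t = i := by intro t; unfold natSwap; grind
  have h₂ : ∀ t, natSwap j t = i + 1 ↔ t = i + 1 := by intro t; unfold natSwap; grind
  have h₃ : ∀ t, i + 1 < natSwap j t ↔ i + 1 < t := by intro t; unfold natSwap; grind
  simp only [strandCocycle, h₁, h₂, h₃]

/-- Two disjoint crossings would need four strands, so one of the factors is trivial. -/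
theorem strandCocycle_comm {i j : ℕ} (h : i + 2 ≤ j) (x y z : ℕ) :
    strandCocycle i x y z * strandCocycle j x y z =
      strandCocycle j x y z * strandCocycle i x y z := by
  unfold strandCocycle
  split_ifs <;> first | omega | simp

set_option maxHeartbeats 1000000 in
theorem strandCocycle_braid (i : ℕ) {x y z : ℕ} (hxy : x ≠ y) (hxz : x ≠ z) (hyz : y ≠ z) :
    strandCocycle i x y z *
        strandCocycle (i + 1) (natSwap i x) (natSwap i y) (natSwap i z) *
        strandCocycle i (natSwap (i + 1) (natSwap i x)) (natSwap (i + 1) (natSwap i y))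
          (natSwap (i + 1) (natSwap i z)) =
      strandCocycle (i + 1) x y z *
        strandCocycle i (natSwap (i + 1) x) (natSwap (i + 1) y) (natSwap (i + 1) z) *
        strandCocycle (i + 1) (natSwap i (natSwap (i + 1) x)) (natSwap i (natSwap (i + 1) y))
          (natSwap i (natSwap (i + 1) z)) := by
  -- A strand away from the three positions matters only through its side, and only for `y`.
  have h : ∀ t, (t ≠ i ∧ t ≠ i + 1 ∧ t ≠ i + 2 ∧ ((¬ i + 1 < t ∧ ¬ i + 2 < t) ∨
      (i + 1 < t ∧ i + 2 < t))) ∨ t = i ∨ t = i + 1 ∨ t = i + 2 := by omega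
  rcases h x with ⟨hx₁, hx₂, hx₃, -⟩ | hx | hx | hx <;>
    rcases h z with ⟨hz₁, hz₂, hz₃, -⟩ | hz | hz | hz <;>
    rcases h y with ⟨hy₁, hy₂, hy₃, ⟨hy₄, hy₅⟩ | ⟨hy₄, hy₅⟩⟩ | hy | hy | hy <;>
    first
    | (exfalso; omega)
    | (try subst x
       try subst y
       try subst z
       simp [*, natSwap, strandCocycle, add_assoc, mul_assoc])

theorem coe_adjSwap (n : ℕ) (i : Fin (n - 1)) (x : Fin n) :
    (adjSwap n i x : ℕ) = natSwap i x := by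
  simp only [adjSwap, Equiv.swap_apply_def, natSwap, Fin.ext_iff]
  split_ifs <;> rfl

/-- The image of a generator of the braid group under the combined forgetful maps. -/
def forgetGenerator (n : ℕ) (i : Fin (n - 1)) :
    ((Fin 3 ↪ Fin n) → FreeGroup (Fin 2)) ⋊[mulAutArrow] Equiv.Perm (Fin n) :=
  ⟨fun τ => strandCocycle i (τ 0) (τ 1) (τ 2), adjSwap n i⟩

theorem mulAutArrow_adjSwap (n : ℕ) (i : Fin (n - 1))
    (F : (Fin 3 ↪ Fin n) → FreeGroup (Fin 2)) (τ : Fin 3 ↪ Fin n) :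
    mulAutArrow (adjSwap n i) F τ = F (adjSwap n i • τ) := by
  have : (adjSwap n i)⁻¹ = adjSwap n i := Equiv.swap_inv _ _
  change F ((adjSwap n i)⁻¹ • τ) = _
  rw [this]

/-- A cocycle with values in functions on triples of strands amounts to a homomorphism to the
semidirect product; injectivity of `τ` supplies the distinctness for the braid relation. -/
theorem forgetGenerator_rel (n : ℕ) :
    ∀ r ∈ {r | BraidRel n r}, FreeGroup.lift (forgetGenerator n) r = 1 := by
  rintro r hr
  have hright : ∀ r, (lift (forgetGenerator n) r).right = lift (adjSwap n) r := by
    intro r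
    have : SemidirectProduct.rightHom.comp (lift (forgetGenerator n)) = lift (adjSwap n) := by
      ext i : 1
      simp [forgetGenerator]
    rw [← this]; rfl
  have hr' := adjSwap_rel n r hr
  rcases hr with ⟨i, j, h⟩ | ⟨i, j, h⟩
  all_goals
    simp only [_root_.map_mul, _root_.map_inv, lift_apply_of, mul_inv_eq_one] at hr' ⊢
    refine SemidirectProduct.ext (funext fun τ => ?_) hr'
    simp only [SemidirectProduct.mul_left, SemidirectProduct.mul_right, _root_.map_mul,
      Pi.mul_apply, MulAut.mul_apply]
    simp only [forgetGenerator, mulAutArrow_adjSwap, Function.Embedding.smul_apply,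
      Equiv.Perm.smul_def, coe_adjSwap]
  · rw [strandCocycle_natSwap (.inr h), strandCocycle_natSwap (.inl h), strandCocycle_comm h]
  · rw [← h]
    apply strandCocycle_braid <;> rw [Ne, Fin.val_inj, τ.injective.eq_iff] <;> decide

/-- The combined homomorphisms that forget all but three strands of a braid. -/
def forgetStrands (n : ℕ) : BraidGroup n →*
    ((Fin 3 ↪ Fin n) → FreeGroup (Fin 2)) ⋊[mulAutArrow] Equiv.Perm (Fin n) :=
  PresentedGroup.toGroup (forgetGenerator_rel n)

theorem forgetStrands_right (n : ℕ) (b : BraidGroup n) :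
    (forgetStrands n b).right = braidPerm n b := by
  have : SemidirectProduct.rightHom.comp (forgetStrands n) = braidPerm n := by
    apply PresentedGroup.ext
    intro i
    simp [forgetStrands, braidPerm, forgetGenerator]
  rw [← this]; rfl

/-- The homomorphism from the pure braid group that forgets all but three strands. -/
def pureForget (n : ℕ) (τ : Fin 3 ↪ Fin n) : PureBraidGroup n →* FreeGroup (Fin 2) where
  toFun b := (forgetStrands n b).left τ
  map_one' := by simp
  map_mul' b c := by
    -- A pure braid acts trivially on the triples, so the cocycle is multiplicative.
    have hb : (forgetStrands n b).right = 1 := by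
      rw [forgetStrands_right]; exact b.2
    simp [hb]

theorem forgetStrands_sq_left (n : ℕ) (i : Fin (n - 1)) (τ : Fin 3 ↪ Fin n) :
    (forgetStrands n (.of i * .of i)).left τ = strandCocycle i (τ 0) (τ 1) (τ 2) *
      strandCocycle i (natSwap i (τ 0)) (natSwap i (τ 1)) (natSwap i (τ 2)) := by
  simp only [_root_.map_mul, forgetStrands, PresentedGroup.toGroup.of,
    SemidirectProduct.mul_left, Pi.mul_apply]
  simp only [forgetGenerator, mulAutArrow_adjSwap, Function.Embedding.smul_apply,
    Equiv.Perm.smul_def, coe_adjSwap]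

theorem sq_mem_pureBraidGroup (n : ℕ) (i : Fin (n - 1)) :
    (.of i * .of i : BraidGroup n) ∈ PureBraidGroup n := by
  rw [MonoidHom.mem_ker, _root_.map_mul, braidPerm, PresentedGroup.toGroup.of]
  exact Equiv.swap_mul_self _ _

theorem PureBraidGroup.exists_surjective {n : ℕ} (hn : 3 ≤ n) :
    ∃ f : PureBraidGroup n →* FreeGroup (Fin 2), Function.Surjective f := by
  -- On the first three strands, $\sigma_0^2$ and $\sigma_1^2$ map to the two free generators.
  refine ⟨pureForget n (Fin.castLEEmb hn), surjective_of_mem_range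
    ⟨⟨_, sq_mem_pureBraidGroup n ⟨0, by omega⟩⟩, ?_⟩
    ⟨⟨_, sq_mem_pureBraidGroup n ⟨1, by omega⟩⟩, ?_⟩⟩
  all_goals
    refine (forgetStrands_sq_left n _ _).trans ?_
    simp [strandCocycle, natSwap]

end PureBraids

theorem corollary5 :
    (∀ n : ℕ, 3 ≤ n →
      (∀ w : FreeGroup ℕ, IsProperWord.{p, q} w →
        ¬ IsRationalSet (verbalSet w (PureBraidGroup n))) ∧
      ∃ φ : PureBraidGroup n →* FreeGroup (Fin 2), Function.Surjective φ) ∧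
    (∀ (V : Type u) (Γ : SimpleGraph V),
      (¬ ∀ a b : RightAngledArtinGroup Γ, a * b = b * a) →
      (∀ w : FreeGroup ℕ, IsProperWord.{p, q} w →
        ¬ IsRationalSet (verbalSet w (RightAngledArtinGroup Γ))) ∧
      ∃ φ : RightAngledArtinGroup Γ →* FreeGroup (Fin 2), Function.Surjective φ) ∧
    (∀ (H : Type v) [Group H], Group.FG H → IsResiduallyFree H →
      (¬ ∀ a b : H, a * b = b * a) →
      (∀ w : FreeGroup ℕ, IsProperWord.{p, q} w → ¬ IsRationalSet (verbalSet w H)) ∧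
      ∃ φ : H →* FreeGroup (Fin 2), Function.Surjective φ) := by
  refine ⟨fun n hn => ?_, fun V Γ h => ?_, fun H _ _ hH h => ?_⟩
  · obtain ⟨f, hf⟩ := PureBraidGroup.exists_surjective hn
    exact ⟨fun w hw => not_isRationalSet_verbalSet_of_surjective hf hw, f, hf⟩
  · obtain ⟨f, hf⟩ := RightAngledArtinGroup.exists_surjective Γ h
    exact ⟨fun w hw => not_isRationalSet_verbalSet_of_surjective hf hw, f, hf⟩
  · obtain ⟨f, hf⟩ := hH.exists_surjective h
    exact ⟨fun w hw => not_isRationalSet_verbalSet_of_surjective hf hw, f, hf⟩
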